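/- **Setting.** Let $k\ge 1$ and $\Pi=\{P_1,\dots,P_k\}$. A ($\Pi$-labeled) graph $G=(V,E,\pi)$ is a finite directed graph with $E\subseteq V\times V$ and $\pi:V\to 2^{\Pi}$; $\mathcal N(v)=\{u\mid (v,u)\in E\}$; its size is $|V|$. A property is a class of pointed graphs $(G,v)$, $v\in V$, closed under isomorphism. **GNNs.** A GNN with aggregation function $\mathrm{AGG}\in\{\mathrm{Max},\mathrm{Mean},\mathrm{Sum}\}$ (applied componentwise to finite multisets of vectors, with value $0$ on the empty multiset) consists of a number $L\ge 1$ of layers, dimensions $\delta^0,\dots,\delta^L$ with $\delta^0\ge k$, arbitrary combination functions $\mathrm{COM}^\ell:\mathbb R^{\delta^{\ell-1}}\times\mathbb R^{\delta^{\ell-1}}\to\mathbb R^{\delta^\ell}$ for $1\le \ell\le L$, and a threshold classification "$x_i\sim c$" with $1\le i\le\delta^L$, ${\sim}\in\{\ge,>\}$, $c\in\mathbb R$. For $i\le k$ the $i$-th entry of $\bar x^0_v$ is $1$ if $P_i\in\pi(v)$; all other entries are $0$. Then $\bar x^\ell_v=\mathrm{COM}^\ell(\bar x^{\ell-1}_v,\mathrm{AGG}\{\!\{\bar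 x_u^{\ell-1}\mid u\in\mathcal N(v)\}\!\})$, and $(G,v)$ is accepted if $(\bar x^L_v)_i\sim c$. The GNN is simple with activation function $f:\mathbb R\to\mathbb R$ if every combination function has the form $\mathrm{COM}^\ell(\bar x,\bar y)=f(\bar xC+\bar yA+\bar b)$ with real matrices $C,A$ and a real vector $\bar b$ (depending on $\ell$), $f$ being applied componentwise. Max-GNN, Mean-GNN, Sum-GNN and their simple versions denote the resulting classes of classifiers. **Logics.** Formulas of ML are $\varphi::=P\mid\neg\varphi\mid\varphi\vee\varphi\mid\Diamond\varphi$ with $P\in\Pi$, where $\Diamond\varphi$ holds at $v$ if some $u\in\mathcal N(v)$ satisfies $\varphi$. In GML the diamond is replaced by $\Diamond^{\ge m}$, $m\in\mathbb N$ (at least $m$ successors satisfy $\varphi$). In RML it is replaced by $\Diamond^{\ge r}$ and $\Diamond^{>r}$, $r\in[0,1]$ (the fraction of successors satisfying $\varphi$ is at least $r$, respectively greater than $r$; at vertices without successors $\Diamond^{\ge r}\varphi$ is true and $\Diamond^{>r}\varphi$ is false). **Non-uniform setting.** A property $P$ is (non-uniformly) expressible by a class $\mathcal C$ of classifiers if for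 every $n\ge 0$ there is $C\in\mathcal C$ such that the pointed graphs of size $n$ accepted by $C$ are exactly those of size $n$ in $P$. Write $\mathcal C_1\subseteq\mathcal C_2$ if every property expressible by $\mathcal C_1$ is expressible by $\mathcal C_2$, and $\mathcal C_1=\mathcal C_2$ if both inclusions hold. **Theorem.** In the non-uniform setting: 1. Max-GNN $=$ simple Max-GNN $=$ ML, where the simple Max-GNNs use a fixed activation function $f$ that is either truncated ReLU, $\min(\max(0,x),1)$, or ReLU, $\max(0,x)$; 2. Mean-GNN $=$ simple Mean-GNN $=$ RML, and 3. Sum-GNN $=$ simple Sum-GNN $=$ GML, where in 2 and 3 the simple GNNs use a fixed activation function $f$ that is truncated ReLU, ReLU, or any continuous function $f:\mathbb R\to\mathbb R$ that is not a polynomial. The same holds if "of size $n$" is replaced by "of size at most $n$" in the definition of expressibility. -/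

import Mathlib

universe u

noncomputable section

namespace NonUniformGNN

/-! ### Labeled graphs, pointed graphs, properties -/

/-- A finite directed graph whose vertices carry labels from `Π = {P_1, …, P_k}`, represented by
`Fin k`. -/
structure LabeledGraph (k : ℕ) where
  V : Type u
  [fintypeV : Fintype V]
  E : V → V → Prop
  label : V → Set (Fin k)

attribute [instance] LabeledGraph.fintypeV

/-- The size of a graph is its number of vertices. -/
def LabeledGraph.size {k : ℕ} (G : LabeledGraph.{u} k) : ℕ := Fintype.card G.V

open Classical in
/-- The neighborhood of a vertex is the set of its successors. -/
def LabeledGraph.succs {k : ℕ} (G : LabeledGraph.{u} k) (v : G.V) : Finset G.V :=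
  Finset.univ.filter fun w => G.E v w

/-- A pointed graph: a graph with a distinguished vertex. -/
structure PointedGraph (k : ℕ) where
  graph : LabeledGraph.{u} k
  vertex : graph.V

/-- Isomorphism of pointed labeled graphs. -/
def PointedGraph.Isomorphic {k : ℕ} (G H : PointedGraph.{u} k) : Prop :=
  ∃ e : G.graph.V ≃ H.graph.V,
    (∀ v w, G.graph.E v w ↔ H.graph.E (e v) (e w)) ∧
    (∀ v, H.graph.label (e v) = G.graph.label v) ∧
    e G.vertex = H.vertex

/-- A (vertex) property: a class of pointed graphs that is closed under isomorphism. -/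
def IsProperty {k : ℕ} (P : Set (PointedGraph.{u} k)) : Prop :=
  ∀ G H : PointedGraph.{u} k, G.Isomorphic H → G ∈ P → H ∈ P

/-! ### Aggregation functions -/

/-- An aggregation function, in every dimension `d`. -/
abbrev Aggregation : Type := ∀ d : ℕ, Multiset (Fin d → ℝ) → Fin d → ℝ

/-- Componentwise sum; the empty sum is `0`. -/
def sumAgg : Aggregation := fun _ M => M.sum

/-- Componentwise mean; the mean of the empty multiset is `0`. -/
def meanAgg : Aggregation := fun _ M =>
  if M = 0 then 0 else (M.card : ℝ)⁻¹ • M.sum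

/-- Componentwise maximum; the maximum of the empty multiset is `0`. -/
def maxAgg : Aggregation := fun _ M i =>
  if h : M = 0 then 0
  else (M.map fun x => x i).toFinset.max' (by
    obtain ⟨x, hx⟩ := Multiset.exists_mem_of_ne_zero h
    exact ⟨x i, Multiset.mem_toFinset.2 (Multiset.mem_map_of_mem _ hx)⟩)

/-! ### Graph neural networks -/

/-- A graph neural network on `k`-labeled graphs in which all layers use the aggregation function
`agg`. Layer `ℓ + 1`, for `ℓ < L`, has input dimension `dim ℓ`, output dimension `dim (ℓ + 1)` and
combination function `com ℓ`; the values of `dim` and `com` beyond the last layer play no role.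
The classification function accepts `x` if `x_i > c` (when `strict` is true) or `x_i ≥ c` (when it
is false), where `i` is `clsIndex` and `c` is `threshold`. -/
structure GNN (agg : Aggregation) (k : ℕ) where
  L : ℕ
  one_le_L : 1 ≤ L
  dim : ℕ → ℕ
  le_dim_zero : k ≤ dim 0
  com : ∀ ℓ : ℕ, (Fin (dim ℓ) → ℝ) → (Fin (dim ℓ) → ℝ) → Fin (dim (ℓ + 1)) → ℝ
  clsIndex : Fin (dim L)
  strict : Bool
  threshold : ℝ

namespace GNN

variable {agg : Aggregation} {k : ℕ}

open Classical in
/-- The feature vector of a vertex after `ℓ` layers. -/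
def feature (N : GNN agg k) (G : LabeledGraph.{u} k) : ∀ ℓ : ℕ, G.V → Fin (N.dim ℓ) → ℝ
  | 0 => fun v i => if ∃ h : (i : ℕ) < k, (⟨i, h⟩ : Fin k) ∈ G.label v then 1 else 0
  | ℓ + 1 => fun v =>
      N.com ℓ (N.feature G ℓ v) (agg (N.dim ℓ) ((G.succs v).val.map (N.feature G ℓ)))

/-- The classification function. -/
def Cls (N : GNN agg k) (x : Fin (N.dim N.L) → ℝ) : Prop :=
  if N.strict then x N.clsIndex > N.threshold else x N.clsIndex ≥ N.threshold

/-- The class of pointed graphs accepted by a graph neural network. -/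
def accepted (N : GNN agg k) : Set (PointedGraph.{u} k) :=
  {G | N.Cls (N.feature G.graph N.L G.vertex)}

/-- A simple graph neural network with activation function `f`: every combination function has the
form `f (x C + y A + b)`, with `f` applied componentwise. -/
def IsSimple (f : ℝ → ℝ) (N : GNN agg k) : Prop :=
  ∀ ℓ < N.L, ∃ (C A : Matrix (Fin (N.dim ℓ)) (Fin (N.dim (ℓ + 1))) ℝ)
    (b : Fin (N.dim (ℓ + 1)) → ℝ),
    ∀ x y, N.com ℓ x y = fun j => f ((Matrix.vecMul x C + Matrix.vecMul y A + b) j)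

end GNN

/-- The rectified linear unit. -/
def relu (x : ℝ) : ℝ := max 0 x

/-- The truncated rectified linear unit. -/
def truncRelu (x : ℝ) : ℝ := min (max 0 x) 1

/-- `f` is a polynomial function. -/
def IsPolynomialFun (f : ℝ → ℝ) : Prop := ∃ p : Polynomial ℝ, ∀ x, f x = p.eval x

/-! ### Modal logics -/

/-- Formulas of modal logic. -/
inductive MLFormula (k : ℕ) : Type
  | atom : Fin k → MLFormula k
  | neg : MLFormula k → MLFormula k
  | or : MLFormula k → MLFormula k → MLFormula k
  | dia : MLFormula k → MLFormula k

/-- Formulas of graded modal logic; `dia n φ` is "at least `n` successors satisfy `φ`". -/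
inductive GMLFormula (k : ℕ) : Type
  | atom : Fin k → GMLFormula k
  | neg : GMLFormula k → GMLFormula k
  | or : GMLFormula k → GMLFormula k → GMLFormula k
  | dia : ℕ → GMLFormula k → GMLFormula k

/-- Formulas of ratio modal logic; `diaGE r φ` and `diaGT r φ` say that the fraction of
successors satisfying `φ` is at least, respectively greater than, the real number `r ∈ [0,1]`. -/
inductive RMLFormula (k : ℕ) : Type
  | atom : Fin k → RMLFormula k
  | neg : RMLFormula k → RMLFormula k
  | or : RMLFormula k → RMLFormula k → RMLFormula k
  | diaGE : Set.Icc (0 : ℝ) 1 → RMLFormula k → RMLFormula k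
  | diaGT : Set.Icc (0 : ℝ) 1 → RMLFormula k → RMLFormula k

/-- Satisfaction for modal logic. -/
def MLFormula.Sat {k : ℕ} (G : LabeledGraph.{u} k) : MLFormula k → G.V → Prop
  | .atom i, v => i ∈ G.label v
  | .neg φ, v => ¬ φ.Sat G v
  | .or φ ψ, v => φ.Sat G v ∨ ψ.Sat G v
  | .dia φ, v => ∃ w ∈ G.succs v, φ.Sat G w

open Classical in
/-- Satisfaction for graded modal logic. -/
def GMLFormula.Sat {k : ℕ} (G : LabeledGraph.{u} k) : GMLFormula k → G.V → Prop
  | .atom i, v => i ∈ G.label v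
  | .neg φ, v => ¬ φ.Sat G v
  | .or φ ψ, v => φ.Sat G v ∨ ψ.Sat G v
  | .dia n φ, v => n ≤ ((G.succs v).filter fun w => φ.Sat G w).card

open Classical in
/-- Satisfaction for ratio modal logic. At a vertex without successors every `diaGE` formula is
true and every `diaGT` formula is false. -/
def RMLFormula.Sat {k : ℕ} (G : LabeledGraph.{u} k) : RMLFormula k → G.V → Prop
  | .atom i, v => i ∈ G.label v
  | .neg φ, v => ¬ φ.Sat G v
  | .or φ ψ, v => φ.Sat G v ∨ ψ.Sat G v
  | .diaGE r φ, v => G.succs v = ∅ ∨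
      (r : ℝ) ≤ (((G.succs v).filter fun w => φ.Sat G w).card : ℝ) / ((G.succs v).card : ℝ)
  | .diaGT r φ, v => G.succs v ≠ ∅ ∧
      (r : ℝ) < (((G.succs v).filter fun w => φ.Sat G w).card : ℝ) / ((G.succs v).card : ℝ)

/-! ### Classes of classifiers

A class of classifiers is represented by the family of the sets of pointed graphs that its members
accept. -/

/-- The class of classifiers of all graph neural networks with aggregation `agg`. -/
def gnnClass (agg : Aggregation) (k : ℕ) : Set (Set (PointedGraph.{u} k)) :=
  {S | ∃ N : GNN agg k, S = N.accepted}

/-- The class of classifiers of all simple graph neural networks with aggregation `agg` and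
activation function `f`. -/
def simpleGNNClass (agg : Aggregation) (f : ℝ → ℝ) (k : ℕ) : Set (Set (PointedGraph.{u} k)) :=
  {S | ∃ N : GNN agg k, N.IsSimple f ∧ S = N.accepted}

/-- Modal logic as a class of classifiers. -/
def mlClass (k : ℕ) : Set (Set (PointedGraph.{u} k)) :=
  {S | ∃ φ : MLFormula k, S = {G | φ.Sat G.graph G.vertex}}

/-- Graded modal logic as a class of classifiers. -/
def gmlClass (k : ℕ) : Set (Set (PointedGraph.{u} k)) :=
  {S | ∃ φ : GMLFormula k, S = {G | φ.Sat G.graph G.vertex}}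

/-- Ratio modal logic as a class of classifiers. -/
def rmlClass (k : ℕ) : Set (Set (PointedGraph.{u} k)) :=
  {S | ∃ φ : RMLFormula k, S = {G | φ.Sat G.graph G.vertex}}

/-! ### Non-uniform expressiveness -/

/-- The two usual ways of fixing the size of graphs in the non-uniform setting: graphs with exactly
`n` vertices, or graphs with at most `n` vertices. -/
inductive SizeMode : Type
  | exactly
  | atMost

/-- A graph with `m` vertices is admitted for the size parameter `n`. -/
def SizeMode.Admits : SizeMode → ℕ → ℕ → Prop
  | .exactly, n, m => m = n
  | .atMost, n, m => m ≤ n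

/-- A property `P` is non-uniformly expressible by a class `𝒞` of classifiers: for every `n` some
member of `𝒞` accepts, among the pointed graphs admitted for `n`, exactly those in `P`. -/
def NonUniformlyExpressible (s : SizeMode) {k : ℕ} (𝒞 : Set (Set (PointedGraph.{u} k)))
    (P : Set (PointedGraph.{u} k)) : Prop :=
  ∀ n : ℕ, ∃ S ∈ 𝒞, ∀ G : PointedGraph.{u} k, s.Admits n G.graph.size → (G ∈ S ↔ G ∈ P)

/-- `𝒞₁ ⊆ 𝒞₂` in the non-uniform setting. -/
def NonUniformSubset (s : SizeMode) {k : ℕ} (𝒞₁ 𝒞₂ : Set (Set (PointedGraph.{u} k))) : Prop :=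
  ∀ P : Set (PointedGraph.{u} k), IsProperty P →
    NonUniformlyExpressible s 𝒞₁ P → NonUniformlyExpressible s 𝒞₂ P

/-- `𝒞₁ = 𝒞₂` in the non-uniform setting. -/
def NonUniformEq (s : SizeMode) {k : ℕ} (𝒞₁ 𝒞₂ : Set (Set (PointedGraph.{u} k))) : Prop :=
  NonUniformSubset s 𝒞₁ 𝒞₂ ∧ NonUniformSubset s 𝒞₂ 𝒞₁

end NonUniformGNN

end

/-!
On graphs with at most `n` vertices only finitely many feature vectors occur in each layer, so even
an arbitrary combination function amounts to a finite case distinction.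

From networks to formulas: call a function on pointed graphs of size at most `n` *finitely
definable* (`FinDefinable`) if it has finitely many values and its fibers are definable in the logic
at hand. Such functions are closed under tupling and arbitrary postcomposition, so arbitrary
combination functions are harmless and only aggregation matters. If `g` is finitely definable, then
its maximum over the successors of a vertex is a function of the set of values that occur there,
its sum is a function of the number of occurrences of each value, and its mean is a function of the
fraction of occurrences of each value. These data are expressible with the diamonds of modal logic,
graded modal logic and ratio modal logic, respectively (`handlesAgg_maxAgg`, `handlesAgg_sumAgg`,
`handlesAgg_meanAgg`).

From formulas to simple networks with maximum aggregation: truth values in `{0, 1}` are computed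
neuron by neuron (`exists_predInd_mem_neurons_maxAgg`); the maximum over the successors is the truth
value of the diamond.

From formulas to simple networks with sum or mean aggregation and a continuous non-polynomial
activation function `f` (truncated ReLU and ReLU are instances): truth values are represented as
*linear combinations* of the neurons of a layer, which is possible because sum and mean are linear
and therefore commute with taking such combinations. The number, or fraction, of successors that
satisfy a formula takes finitely many values, and on a finite set of reals every function is a
linear combination of functions `x ↦ f (b + x * w)` (`exists_interpolation`). Thus the next layer
can apply any threshold to it, and the Boolean connectives are treated in the same way
(`exists_comp_mem_span_neurons`).

The interpolation property holds because a linear dependence `∑ c x * f (b + x * w) = 0`, valid for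
all `b` and `w`, can be reduced to a single term by taking differences, which yields a vanishing
iterated difference of `f`; for a continuous function this means that it is a polynomial
(`isPolynomialFun_of_fwdDiff_iter_eq_zero`).
-/

noncomputable section

namespace NonUniformGNN

/-! ### Ridge functions of a continuous non-polynomial function -/

/-- If a sum of functions of the distinct linear forms `b + x * w` vanishes identically, then each
summand is annihilated by iterated differences: shifting `(b, w)` along a line on which the form of
one other summand is constant and subtracting eliminates that summand, at the price of one
difference operator. -/
theorem fwdDiff_iter_eq_zero_of_sum_eq_zero (x₀ : ℝ) (t : Finset ℝ) (hx₀ : x₀ ∉ t)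
    (g : ℝ → ℝ → ℝ)
    (H : ∀ b w : ℝ, g x₀ (b + x₀ * w) + ∑ x ∈ t, g x (b + x * w) = 0) (h : ℝ) :
    (fwdDiff h)^[t.card] (g x₀) = 0 := by
  induction t using Finset.induction_on generalizing g with
  | empty =>
    funext y
    simpa using H y 0
  | insert a t ha ih =>
    rw [Finset.mem_insert, not_or] at hx₀
    have hne : x₀ - a ≠ 0 := sub_ne_zero.2 hx₀.1
    -- The shift `η` is chosen so that the form of the summand `x₀` moves by exactly `h`.
    set η : ℝ := h / (x₀ - a) with hη
    have key := ih hx₀.2 (fun x => fwdDiff ((x - a) * η) (g x)) (by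
      intro b w
      have h₁ := H (b - a * η) (w + η)
      have h₂ := H b w
      rw [Finset.sum_insert ha] at h₁ h₂
      have e : ∀ x : ℝ, b - a * η + x * (w + η) = b + x * w + (x - a) * η := fun x => by ring
      simp only [e] at h₁
      simp only [sub_self, zero_mul, add_zero] at h₁
      simp only [fwdDiff, Finset.sum_sub_distrib]
      linarith)
    have e : (x₀ - a) * η = h := by rw [hη]; field_simp
    simp only [e] at key
    rw [Finset.card_insert_of_notMem ha, Function.iterate_succ_apply]
    exact key

/-- Newton's formula: a function with vanishing iterated differences is polynomial on every
arithmetic progression. -/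
theorem exists_polynomial_on_progression {f : ℝ → ℝ} {m : ℕ} (y h : ℝ)
    (H : (fwdDiff h)^[m] f = 0) :
    ∃ q : Polynomial ℝ, ∀ n : ℕ, f (y + n * h) = q.eval (n : ℝ) := by
  refine ⟨∑ j ∈ Finset.range m, Polynomial.C ((fwdDiff h)^[j] f y / (j.factorial : ℝ)) *
    descPochhammer ℝ j, fun n => ?_⟩
  have hz : ∀ j, m ≤ j → (fwdDiff h)^[j] f y = 0 := by
    intro j hj
    obtain ⟨i, rfl⟩ := Nat.exists_eq_add_of_le' hj
    rw [Function.iterate_add_apply, H]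
    have : (fwdDiff h)^[i] (0 : ℝ → ℝ) = 0 :=
      Function.iterate_fixed (by funext z; simp [fwdDiff]) i
    rw [this]; rfl
  have key := shift_eq_sum_fwdDiff_iter h f n y
  rw [nsmul_eq_mul] at key
  rw [key, Polynomial.eval_finsetSum]
  have e : ∀ j, n.choose j • (fwdDiff h)^[j] f y =
      (Polynomial.C ((fwdDiff h)^[j] f y / (j.factorial : ℝ)) * descPochhammer ℝ j).eval (n : ℝ) := by
    intro j
    rw [nsmul_eq_mul, Nat.cast_choose_eq_descPochhammer_div, Polynomial.eval_mul,
      Polynomial.eval_C]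
    ring
  rw [Finset.sum_congr rfl fun j _ => e j]
  -- Both sums agree with the sum over the larger range: binomials vanish above `n`, differences
  -- vanish from `m` on.
  have h₁ : Finset.range (n + 1) ⊆ Finset.range (n + 1 + m) := by
    intro i; simp only [Finset.mem_range]; omega
  have h₂ : Finset.range m ⊆ Finset.range (n + 1 + m) := by
    intro i; simp only [Finset.mem_range]; omega
  rw [Finset.sum_subset h₁, Finset.sum_subset h₂]
  · intro j _ hj
    rw [← e, hz j (by simpa using hj), smul_zero]
  · intro j _ hj
    rw [← e, Nat.choose_eq_zero_of_lt (by rw [Finset.mem_range] at hj; omega), zero_smul]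

/-- A continuous function with vanishing iterated differences is polynomial on every half-line. -/
theorem exists_polynomial_on_halfLine {f : ℝ → ℝ} (hf : Continuous f) {m : ℕ}
    (H : ∀ h : ℝ, (fwdDiff h)^[m] f = 0) (y : ℝ) :
    ∃ p : Polynomial ℝ, ∀ t : ℝ, 0 ≤ t → f (y + t) = p.eval t := by
  obtain ⟨p, hp⟩ := exists_polynomial_on_progression y 1 (H 1)
  have hrat : ∀ N : ℕ, 0 < N → ∀ n : ℕ, f (y + n / N) = p.eval ((n : ℝ) / N) := by
    intro N hN n
    have hN' : (N : ℝ) ≠ 0 := by positivity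
    obtain ⟨q, hq⟩ := exists_polynomial_on_progression y (1 / N : ℝ) (H _)
    -- The polynomials for the steps `1` and `1 / N` agree on the natural numbers.
    have hpq : p = q.comp (Polynomial.C (N : ℝ) * Polynomial.X) := by
      refine Polynomial.eq_of_infinite_eval_eq _ _
        ((Set.infinite_range_of_injective (Nat.cast_injective (R := ℝ))).mono ?_)
      rintro _ ⟨i, rfl⟩
      have := hq (N * i)
      simp only [Set.mem_ofPred_eq, Polynomial.eval_comp, Polynomial.eval_mul, Polynomial.eval_C,
        Polynomial.eval_X]
      rw [← hp i, ← Nat.cast_mul, ← this]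
      push_cast
      congr 1
      field_simp
    rw [hpq]
    simp only [Polynomial.eval_comp, Polynomial.eval_mul, Polynomial.eval_C, Polynomial.eval_X]
    rw [mul_div_cancel₀ _ hN', ← hq n, mul_one_div]
  refine ⟨p, fun t ht => ?_⟩
  have hlim : Filter.Tendsto (fun N : ℕ => ((⌊t * (N : ℝ)⌋₊ : ℕ) : ℝ) / (N : ℝ)) Filter.atTop
      (nhds t) :=
    (tendsto_nat_floor_mul_div_atTop ht).comp tendsto_natCast_atTop_atTop
  have h₁ : Filter.Tendsto (fun N : ℕ => f (y + (⌊t * (N : ℝ)⌋₊ : ℕ) / (N : ℝ))) Filter.atTop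
      (nhds (f (y + t))) :=
    ((hf.comp (continuous_const.add continuous_id)).tendsto t).comp hlim
  have h₂ : Filter.Tendsto (fun N : ℕ => f (y + (⌊t * (N : ℝ)⌋₊ : ℕ) / (N : ℝ))) Filter.atTop
      (nhds (p.eval t)) := by
    refine Filter.Tendsto.congr' ?_ ((p.continuous.tendsto t).comp hlim)
    filter_upwards [Filter.eventually_gt_atTop 0] with N hN
    exact (hrat N hN _).symm
  exact tendsto_nhds_unique h₁ h₂

/-- Fréchet's characterization of polynomials among continuous functions. -/
theorem isPolynomialFun_of_fwdDiff_iter_eq_zero {f : ℝ → ℝ} (hf : Continuous f) {m : ℕ}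
    (H : ∀ h : ℝ, (fwdDiff h)^[m] f = 0) : IsPolynomialFun f := by
  obtain ⟨p, hp⟩ := exists_polynomial_on_halfLine hf H 0
  refine ⟨p, fun x => ?_⟩
  -- The polynomial on the half-line from `x` agrees, after translation, with `p` far to the right.
  obtain ⟨q, hq⟩ := exists_polynomial_on_halfLine hf H x
  have hqp : q = p.comp (Polynomial.X + Polynomial.C x) := by
    refine Polynomial.eq_of_infinite_eval_eq _ _ ((Set.Ici_infinite |x|).mono fun t ht => ?_)
    have ht' : |x| ≤ t := ht
    have h₁ := hq t ((abs_nonneg x).trans ht')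
    have h₂ := hp (x + t) (by linarith [neg_abs_le x])
    rw [zero_add] at h₂
    simp only [Set.mem_ofPred_eq, Polynomial.eval_comp, Polynomial.eval_add, Polynomial.eval_X,
      Polynomial.eval_C]
    rw [← h₁, h₂, add_comm]
  have h₀ := hq 0 le_rfl
  rw [add_zero] at h₀
  simp [h₀, hqp]

/-- On a finite set of reals, every function is a linear combination of the functions
`x ↦ f (b + x * w)`. -/
theorem exists_interpolation {f : ℝ → ℝ} (hf : Continuous f) (hp : ¬ IsPolynomialFun f)
    (S : Finset ℝ) (g : ℝ → ℝ) :
    ∃ c : ℝ × ℝ →₀ ℝ, ∀ x ∈ S, g x = c.sum fun z a => a * f (z.1 + x * z.2) := by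
  classical
  set F : ℝ × ℝ → S → ℝ := fun z x => f (z.1 + x * z.2) with hF
  have hspan : Submodule.span ℝ (Set.range F) = ⊤ := by
    by_contra hne
    obtain ⟨l, hl, hker⟩ := Submodule.exists_le_ker_of_lt_top _ (lt_top_iff_ne_top.2 hne)
    set e : S → ℝ := fun x => l (Pi.single x 1) with he
    have hsum : ∀ u : S → ℝ, l u = ∑ x, u x * e x := by
      intro u
      conv_lhs => rw [pi_eq_sum_univ' u]
      simp only [map_sum, map_smul, smul_eq_mul, he]
    obtain ⟨x₀, hx₀⟩ : ∃ x, e x ≠ 0 := by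
      by_contra hcon
      push Not at hcon
      exact hl (LinearMap.ext fun u => by simp [hsum, hcon])
    have H := fwdDiff_iter_eq_zero_of_sum_eq_zero x₀ (S.erase x₀) (Finset.notMem_erase _ _)
      (fun x => (if hx : x ∈ S then e ⟨x, hx⟩ else 0) • f) (by
        intro b w
        rw [Finset.add_sum_erase S (fun x => ((if hx : x ∈ S then e ⟨x, hx⟩ else 0) • f)
          (b + x * w)) x₀.2, ← Finset.sum_coe_sort]
        have := hker (Submodule.subset_span ⟨(b, w), rfl⟩)
        rw [LinearMap.mem_ker, hsum] at this
        rw [← this]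
        refine Finset.sum_congr rfl fun x _ => ?_
        simp [hF, mul_comm])
    refine hp (isPolynomialFun_of_fwdDiff_iter_eq_zero hf (m := (S.erase x₀).card) fun h => ?_)
    have := H h
    simp only [Subtype.coe_eta, Finset.coe_mem, dif_pos] at this
    rw [fwdDiff_iter_const_smul] at this
    exact (smul_eq_zero.1 this).resolve_left hx₀
  have hg : (fun x : S => g x) ∈ Submodule.span ℝ (Set.range F) := hspan ▸ Submodule.mem_top
  obtain ⟨c, hc⟩ := (Finsupp.mem_span_range_iff_exists_finsupp).1 hg
  refine ⟨c, fun x hx => ?_⟩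
  have := congrFun hc ⟨x, hx⟩
  simp only [Finsupp.sum, Finset.sum_apply, Pi.smul_apply, smul_eq_mul] at this
  rw [← this]
  rfl

theorem continuous_relu : Continuous relu := continuous_const.max continuous_id

theorem continuous_truncRelu : Continuous truncRelu := continuous_relu.min continuous_const

/-- A function that vanishes on the negative reals but not at `1` is not a polynomial. -/
theorem not_isPolynomialFun_of_vanishing {f : ℝ → ℝ} (h₀ : ∀ x < 0, f x = 0) (h₁ : f 1 ≠ 0) :
    ¬ IsPolynomialFun f := by
  rintro ⟨p, hp⟩
  have : p = 0 := Polynomial.eq_of_infinite_eval_eq _ _ ((Set.Iio_infinite (0 : ℝ)).mono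
    fun x hx => by simp [← hp, h₀ x hx])
  exact h₁ (by simp [hp, this])

theorem not_isPolynomialFun_relu : ¬ IsPolynomialFun relu :=
  not_isPolynomialFun_of_vanishing (fun x hx => max_eq_left hx.le) (by norm_num [relu])

theorem not_isPolynomialFun_truncRelu : ¬ IsPolynomialFun truncRelu :=
  not_isPolynomialFun_of_vanishing (fun x hx => by simp [truncRelu, hx.le])
    (by norm_num [truncRelu])

/-! ### Simple networks as spans of neurons -/

/-- The aggregation of multisets of real numbers that is induced by an aggregation function. -/
def scalarAgg (agg : Aggregation) (M : Multiset ℝ) : ℝ := agg 1 (M.map fun x _ => x) 0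

/-- An aggregation function that acts on every component by its scalar version. -/
def IsComponentwise (agg : Aggregation) : Prop :=
  ∀ (d : ℕ) (M : Multiset (Fin d → ℝ)) (i : Fin d), agg d M i = scalarAgg agg (M.map fun x => x i)

variable {k : ℕ}

/-- The aggregate of a real-valued function on pointed graphs over the successors of the
distinguished vertex. -/
def aggSucc (agg : Aggregation) (g : PointedGraph.{u} k → ℝ) (p : PointedGraph.{u} k) : ℝ :=
  scalarAgg agg ((p.graph.succs p.vertex).val.map fun w => g ⟨p.graph, w⟩)

open Classical in
/-- The `{0, 1}`-valued function that indicates whether the distinguished vertex has label `i`. It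
is defined for all natural numbers `i`, being `0` from `k` on. -/
def labelInd (i : ℕ) (p : PointedGraph.{u} k) : ℝ :=
  if ∃ h : i < k, (⟨i, h⟩ : Fin k) ∈ p.graph.label p.vertex then 1 else 0

/-- The inputs that can be fed to the activation function in the layer after one whose neurons
compute the functions in `K`: affine combinations of these functions and their aggregates. -/
def preActivations (agg : Aggregation) (K : Set (PointedGraph.{u} k → ℝ)) :
    Submodule ℝ (PointedGraph.{u} k → ℝ) :=
  Submodule.span ℝ (K ∪ aggSucc agg '' K ∪ {1})

/-- The functions computed by the neurons in layer `ℓ` of simple networks of arbitrary width. -/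
def neurons (agg : Aggregation) (f : ℝ → ℝ) (k : ℕ) : ℕ → Set (PointedGraph.{u} k → ℝ)
  | 0 => Set.range fun i : Fin k => labelInd i
  | ℓ + 1 => (fun g => f ∘ g) '' (preActivations agg (neurons agg f k ℓ) : Set _)

/-- The weights of one layer of width `D`: the two matrices and the bias. -/
abbrev LayerWeights (D : ℕ) : Type :=
  Matrix (Fin D) (Fin D) ℝ × Matrix (Fin D) (Fin D) ℝ × (Fin D → ℝ)

/-- The function computed by neuron `i` in layer `ℓ` of the simple network in which all layers have
width `D`, with weights `W`. -/
def neuron (agg : Aggregation) (f : ℝ → ℝ) {D : ℕ} (W : ℕ → LayerWeights D) :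
    ℕ → Fin D → PointedGraph.{u} k → ℝ
  | 0, i => labelInd i
  | ℓ + 1, i => fun p =>
      f (∑ j, neuron agg f W ℓ j p * (W ℓ).1 j i +
        ∑ j, aggSucc agg (neuron agg f W ℓ j) p * (W ℓ).2.1 j i + (W ℓ).2.2 i)

theorem neuron_congr (agg : Aggregation) (f : ℝ → ℝ) {D : ℕ} {W W' : ℕ → LayerWeights D} (ℓ : ℕ)
    (h : ∀ m < ℓ, W m = W' m) :
    (neuron agg f W ℓ : Fin D → PointedGraph.{u} k → ℝ) = neuron agg f W' ℓ := by
  induction ℓ with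
  | zero => rfl
  | succ ℓ ih =>
    funext i
    simp only [neuron, ih fun m hm => h m (hm.trans ℓ.lt_succ_self), h ℓ ℓ.lt_succ_self]

/-- An affine combination of the functions in `K` and their aggregates involves only finitely many
of them, and is computed from any finite family in which these occur. -/
theorem exists_weights_of_mem_preActivations {agg : Aggregation}
    {K : Set (PointedGraph.{u} k → ℝ)} {g : PointedGraph.{u} k → ℝ}
    (hg : g ∈ preActivations agg K) :
    ∃ T : Finset (PointedGraph.{u} k → ℝ), ↑T ⊆ K ∧
      ∀ (D : ℕ) (e : Fin D → PointedGraph.{u} k → ℝ), ↑T ⊆ Set.range e →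
        ∃ (c a : Fin D → ℝ) (b : ℝ), ∀ p,
          g p = ∑ j, e j p * c j + ∑ j, aggSucc agg (e j) p * a j + b := by
  classical
  induction hg using Submodule.span_induction with
  | mem g hg =>
    rcases hg with (hg | ⟨h, hh, rfl⟩) | rfl
    · refine ⟨{g}, by simpa using hg, fun D e he => ?_⟩
      obtain ⟨j, hj⟩ := he (by simp : g ∈ _)
      exact ⟨Pi.single j 1, 0, 0, fun p => by simp [Pi.single_apply, hj]⟩
    · refine ⟨{h}, by simpa using hh, fun D e he => ?_⟩
      obtain ⟨j, hj⟩ := he (by simp : h ∈ _)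
      exact ⟨0, Pi.single j 1, 0, fun p => by simp [Pi.single_apply, hj]⟩
    · exact ⟨∅, by simp, fun D e _ => ⟨0, 0, 1, fun p => by simp⟩⟩
  | zero => exact ⟨∅, by simp, fun D e _ => ⟨0, 0, 0, fun p => by simp⟩⟩
  | add g g' _ _ ih ih' =>
    obtain ⟨T, hT, h⟩ := ih
    obtain ⟨T', hT', h'⟩ := ih'
    refine ⟨T ∪ T', by simp [hT, hT'], fun D e he => ?_⟩
    rw [Finset.coe_union, Set.union_subset_iff] at he
    obtain ⟨c, a, b, hg⟩ := h D e he.1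
    obtain ⟨c', a', b', hg'⟩ := h' D e he.2
    refine ⟨c + c', a + a', b + b', fun p => ?_⟩
    simp only [Pi.add_apply, hg, hg', mul_add, Finset.sum_add_distrib]
    ring
  | smul r g _ ih =>
    obtain ⟨T, hT, h⟩ := ih
    refine ⟨T, hT, fun D e he => ?_⟩
    obtain ⟨c, a, b, hg⟩ := h D e he
    refine ⟨r • c, r • a, r * b, fun p => ?_⟩
    simp only [Pi.smul_apply, smul_eq_mul, hg, mul_add, Finset.mul_sum, mul_left_comm]

/-- Finitely many neurons of a layer can be accommodated in a single network of any sufficiently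
large width. -/
theorem exists_weights_of_subset_neurons (agg : Aggregation) (f : ℝ → ℝ) (ℓ : ℕ)
    (T : Finset (PointedGraph.{u} k → ℝ)) (hT : ↑T ⊆ neurons agg f k ℓ) :
    ∃ D₀ : ℕ, ∀ D ≥ D₀, ∃ W : ℕ → LayerWeights D,
      (T : Set (PointedGraph.{u} k → ℝ)) ⊆ Set.range (neuron agg f W ℓ) := by
  classical
  induction ℓ generalizing T with
  | zero =>
    refine ⟨k, fun D hD => ⟨fun _ => 0, fun g hg => ?_⟩⟩
    obtain ⟨i, rfl⟩ := hT hg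
    exact ⟨⟨i, i.2.trans_le hD⟩, rfl⟩
  | succ ℓ ih =>
    choose! v hv hvg using fun g (hg : g ∈ T) => hT hg
    choose! S hS hw using fun g (hg : g ∈ T) => exists_weights_of_mem_preActivations (hv g hg)
    obtain ⟨D₀, hD₀⟩ := ih (T.biUnion S) (by simpa using hS)
    refine ⟨max D₀ T.card, fun D hD => ?_⟩
    obtain ⟨W, hW⟩ := hD₀ D ((le_max_left _ _).trans hD)
    choose! c a b hcab using fun g (hg : g ∈ T) => hw g hg D (neuron agg f W ℓ)
      ((Finset.coe_subset.2 (Finset.subset_biUnion_of_mem S hg)).trans hW)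
    -- The neurons of the new layer are assigned to the members of `T`.
    obtain ⟨r, hr⟩ : ∃ r : Fin D → PointedGraph.{u} k → ℝ, ∀ g ∈ T, ∃ i, r i = g := by
      refine ⟨fun i => T.toList.getD i 0, fun g hg => ?_⟩
      obtain ⟨i, hi, rfl⟩ := List.getElem_of_mem (Finset.mem_toList.2 hg)
      refine ⟨⟨i, ?_⟩, List.getD_eq_getElem _ _ hi⟩
      rw [Finset.length_toList] at hi
      exact hi.trans_le ((le_max_right _ _).trans hD)
    set W' : ℕ → LayerWeights D := Function.update W ℓ
      (fun j i => c (r i) j, fun j i => a (r i) j, fun i => b (r i)) with hW'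
    have hlow : (neuron agg f W' ℓ : Fin D → PointedGraph.{u} k → ℝ) = neuron agg f W ℓ :=
      neuron_congr agg f ℓ fun m hm => Function.update_of_ne hm.ne _ _
    refine ⟨W', fun g hg => ?_⟩
    obtain ⟨i, rfl⟩ := hr g hg
    refine ⟨i, ?_⟩
    conv_rhs => rw [← hvg _ hg]
    funext p
    simp only [neuron, hlow, Function.comp_apply, hcab _ hg p]
    simp [hW']

/-- The simple network with `L` layers of width `D` and weights `W` that accepts if neuron `i` of
the last layer has value at least `c`. -/
def uniformNet (agg : Aggregation) (f : ℝ → ℝ) {D L : ℕ} (hD : k ≤ D) (hL : 1 ≤ L)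
    (W : ℕ → LayerWeights D) (i : Fin D) (c : ℝ) : GNN agg k where
  L := L
  one_le_L := hL
  dim _ := D
  le_dim_zero := hD
  com ℓ x y := fun j =>
    f ((Matrix.vecMul x (W ℓ).1 + Matrix.vecMul y (W ℓ).2.1 + (W ℓ).2.2) j)
  clsIndex := i
  strict := false
  threshold := c

theorem feature_uniformNet {agg : Aggregation} (hagg : IsComponentwise agg) (f : ℝ → ℝ) {D L : ℕ}
    (hD : k ≤ D) (hL : 1 ≤ L) (W : ℕ → LayerWeights D) (i : Fin D) (c : ℝ)
    (G : LabeledGraph.{u} k) (ℓ : ℕ) (v : G.V) (j : Fin D) :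
    (uniformNet agg f hD hL W i c).feature G ℓ v j = neuron agg f W ℓ j ⟨G, v⟩ := by
  induction ℓ generalizing v j with
  | zero => rfl
  | succ ℓ ih =>
    have key : ∀ F : G.V → Fin D → ℝ, (∀ v j, F v j = neuron agg f W ℓ j ⟨G, v⟩) →
        f ((Matrix.vecMul (F v) (W ℓ).1 +
          Matrix.vecMul (agg D ((G.succs v).val.map F)) (W ℓ).2.1 + (W ℓ).2.2) j) =
        neuron agg f W (ℓ + 1) j ⟨G, v⟩ := by
      intro F hF
      have hy : ∀ j', agg D ((G.succs v).val.map F) j' =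
          aggSucc agg (neuron agg f W ℓ j') ⟨G, v⟩ := by
        intro j'
        rw [hagg, Multiset.map_map]
        simp only [aggSucc, Function.comp_def, hF]
      simp only [Pi.add_apply, Matrix.vecMul, dotProduct, neuron, hy, hF]
    exact key _ ih

theorem mem_accepted_of_not_strict {agg : Aggregation} {N : GNN agg k} (h : N.strict = false)
    {p : PointedGraph.{u} k} :
    p ∈ N.accepted ↔ N.threshold ≤ N.feature p.graph N.L p.vertex N.clsIndex := by
  simp [GNN.accepted, GNN.Cls, h]

/-- Thresholds of neurons are accepted by simple networks. -/
theorem setOf_le_mem_simpleGNNClass {agg : Aggregation} (hagg : IsComponentwise agg) {f : ℝ → ℝ}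
    {L : ℕ} (hL : 1 ≤ L) {g : PointedGraph.{u} k → ℝ} (hg : g ∈ neurons agg f k L) (c : ℝ) :
    {p | c ≤ g p} ∈ simpleGNNClass.{u} agg f k := by
  obtain ⟨D₀, hD₀⟩ := exists_weights_of_subset_neurons agg f L {g} (by simpa using hg)
  obtain ⟨W, hW⟩ := hD₀ (max D₀ k) (le_max_left _ _)
  obtain ⟨i, rfl⟩ := hW (by simp : g ∈ _)
  refine ⟨uniformNet agg f (le_max_right _ _) hL W i c,
    fun ℓ _ => ⟨(W ℓ).1, (W ℓ).2.1, (W ℓ).2.2, fun x y => rfl⟩, ?_⟩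
  ext p
  have hp := feature_uniformNet hagg f (le_max_right D₀ k) hL W i c p.graph L p.vertex i
  rw [mem_accepted_of_not_strict rfl]
  exact ⟨fun h => le_of_le_of_eq h hp.symm, fun h => le_of_le_of_eq h hp⟩

/-! ### The three aggregation functions -/

theorem scalarAgg_sumAgg (M : Multiset ℝ) : scalarAgg sumAgg M = M.sum := by
  simp [scalarAgg, sumAgg, Pi.multiset_sum_apply]

theorem meanAgg_eq {d : ℕ} (M : Multiset (Fin d → ℝ)) :
    meanAgg d M = (M.card : ℝ)⁻¹ • M.sum := by
  unfold meanAgg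
  split_ifs with h <;> simp [h]

theorem scalarAgg_meanAgg (M : Multiset ℝ) : scalarAgg meanAgg M = (M.card : ℝ)⁻¹ * M.sum := by
  simp [scalarAgg, meanAgg_eq, Pi.multiset_sum_apply]

theorem isComponentwise_sumAgg : IsComponentwise sumAgg := fun d M i => by
  rw [scalarAgg_sumAgg, sumAgg, Pi.multiset_sum_apply]

theorem isComponentwise_meanAgg : IsComponentwise meanAgg := fun d M i => by
  rw [scalarAgg_meanAgg, meanAgg_eq, Pi.smul_apply, Pi.multiset_sum_apply, Multiset.card_map,
    smul_eq_mul]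

theorem maxAgg_zero (d : ℕ) : maxAgg d 0 = 0 := by
  funext i
  simp [maxAgg]

theorem isGreatest_maxAgg {d : ℕ} {M : Multiset (Fin d → ℝ)} (hM : M ≠ 0) (i : Fin d) :
    IsGreatest {y | ∃ x ∈ M, x i = y} (maxAgg d M i) := by
  have : {y | ∃ x ∈ M, x i = y} = ((M.map fun x => x i).toFinset : Set ℝ) := by ext; simp
  rw [this, maxAgg, dif_neg hM]
  exact Finset.isGreatest_max' _ _

theorem isComponentwise_maxAgg : IsComponentwise maxAgg := fun d M i => by
  rcases eq_or_ne M 0 with rfl | hM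
  · simp [scalarAgg, maxAgg_zero]
  · refine (isGreatest_maxAgg hM i).unique ?_
    have := isGreatest_maxAgg (M := (M.map fun x => x i).map fun x (_ : Fin 1) => x)
      (by simpa using hM) 0
    simpa [scalarAgg] using this

/-- The componentwise maximum depends only on the set of vectors that occur. -/
theorem maxAgg_congr {d : ℕ} {M M' : Multiset (Fin d → ℝ)} (h : ∀ x, x ∈ M ↔ x ∈ M') :
    maxAgg d M = maxAgg d M' := by
  rcases eq_or_ne M 0 with rfl | hM
  · rw [Multiset.eq_zero_of_forall_notMem (s := M') fun x hx => by simpa using (h x).2 hx]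
  · have hM' : M' ≠ 0 := by
      rintro rfl
      exact hM (Multiset.eq_zero_of_forall_notMem fun x hx => by simpa using (h x).1 hx)
    funext i
    have := isGreatest_maxAgg hM i
    simp only [h] at this
    exact this.unique (isGreatest_maxAgg hM' i)

theorem aggSucc_sumAgg (g : PointedGraph.{u} k → ℝ) (p : PointedGraph.{u} k) :
    aggSucc sumAgg g p = ∑ w ∈ p.graph.succs p.vertex, g ⟨p.graph, w⟩ :=
  scalarAgg_sumAgg _

theorem aggSucc_meanAgg (g : PointedGraph.{u} k → ℝ) (p : PointedGraph.{u} k) :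
    aggSucc meanAgg g p =
      ((p.graph.succs p.vertex).card : ℝ)⁻¹ * ∑ w ∈ p.graph.succs p.vertex, g ⟨p.graph, w⟩ := by
  rw [aggSucc, scalarAgg_meanAgg, Multiset.card_map]
  rfl

/-! ### From modal logic to simple networks with maximum aggregation -/

open Classical in
/-- The `{0, 1}`-valued indicator function of a predicate on pointed graphs. -/
def predInd (Q : PointedGraph.{u} k → Prop) (p : PointedGraph.{u} k) : ℝ := if Q p then 1 else 0

theorem predInd_eq_zero_or_one (Q : PointedGraph.{u} k → Prop) (p : PointedGraph.{u} k) :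
    predInd Q p = 0 ∨ predInd Q p = 1 := by
  unfold predInd
  split_ifs <;> simp

theorem labelInd_eq_predInd (i : Fin k) :
    (labelInd i : PointedGraph.{u} k → ℝ) = predInd fun p => i ∈ p.graph.label p.vertex := by
  classical
  funext p
  unfold labelInd predInd
  exact if_congr ⟨fun ⟨_, h⟩ => h, fun h => ⟨i.2, h⟩⟩ rfl rfl

theorem comp_mem_neurons {agg : Aggregation} {f : ℝ → ℝ} {ℓ : ℕ} {v g : PointedGraph.{u} k → ℝ}
    (hv : v ∈ preActivations agg (neurons agg f k ℓ)) (hg : ∀ p, f (v p) = g p) :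
    g ∈ neurons agg f k (ℓ + 1) :=
  ⟨v, hv, funext hg⟩

theorem mem_preActivations {agg : Aggregation} {K : Set (PointedGraph.{u} k → ℝ)}
    {g : PointedGraph.{u} k → ℝ} (hg : g ∈ K) : g ∈ preActivations agg K :=
  Submodule.subset_span (Or.inl (Or.inl hg))

theorem aggSucc_mem_preActivations {agg : Aggregation} {K : Set (PointedGraph.{u} k → ℝ)}
    {g : PointedGraph.{u} k → ℝ} (hg : g ∈ K) : aggSucc agg g ∈ preActivations agg K :=
  Submodule.subset_span (Or.inl (Or.inr ⟨g, hg, rfl⟩))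

theorem one_mem_preActivations (agg : Aggregation) (K : Set (PointedGraph.{u} k → ℝ)) :
    1 ∈ preActivations agg K :=
  Submodule.subset_span (Or.inr rfl)

theorem aggSucc_maxAgg_predInd (Q : PointedGraph.{u} k → Prop) (p : PointedGraph.{u} k) :
    aggSucc maxAgg (predInd Q) p =
      predInd (fun p => ∃ w ∈ p.graph.succs p.vertex, Q ⟨p.graph, w⟩) p := by
  classical
  rcases (p.graph.succs p.vertex).eq_empty_or_nonempty with h | ⟨w₀, hw₀⟩
  · simp [aggSucc, scalarAgg, predInd, h, maxAgg_zero]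
  · have hG := isGreatest_maxAgg (M := (((p.graph.succs p.vertex).val.map fun w =>
      predInd Q ⟨p.graph, w⟩).map fun x (_ : Fin 1) => x)) (by
        rw [Multiset.map_map]
        intro h0
        rw [Multiset.map_eq_zero] at h0
        simp [Finset.val_eq_zero.1 h0] at hw₀) 0
    refine hG.unique ?_
    by_cases h : ∃ w ∈ p.graph.succs p.vertex, Q ⟨p.graph, w⟩
    · obtain ⟨w, hw, hQ⟩ := h
      have e : predInd (fun p => ∃ w ∈ p.graph.succs p.vertex, Q ⟨p.graph, w⟩) p = 1 :=
        if_pos ⟨w, hw, hQ⟩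
      rw [e]
      refine ⟨⟨fun _ => 1, ?_, rfl⟩, ?_⟩
      · simp only [Multiset.map_map, Multiset.mem_map, Function.comp_apply]
        exact ⟨w, hw, funext fun _ => if_pos hQ⟩
      · rintro y ⟨x, hx, rfl⟩
        simp only [Multiset.map_map, Multiset.mem_map, Function.comp_apply] at hx
        obtain ⟨w', -, rfl⟩ := hx
        rcases predInd_eq_zero_or_one Q ⟨p.graph, w'⟩ with h | h <;> simp [h]
    · have e : predInd (fun p => ∃ w ∈ p.graph.succs p.vertex, Q ⟨p.graph, w⟩) p = 0 := if_neg h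
      have hz : ∀ w ∈ p.graph.succs p.vertex, predInd Q ⟨p.graph, w⟩ = 0 :=
        fun w hw => if_neg fun hQ => h ⟨w, hw, hQ⟩
      rw [e]
      refine ⟨⟨fun _ => 0, ?_, rfl⟩, ?_⟩
      · simp only [Multiset.map_map, Multiset.mem_map, Function.comp_apply]
        exact ⟨w₀, hw₀, funext fun _ => hz w₀ hw₀⟩
      · rintro y ⟨x, hx, rfl⟩
        simp only [Multiset.map_map, Multiset.mem_map, Function.comp_apply] at hx
        obtain ⟨w', hw', rfl⟩ := hx
        exact (hz w' hw').le

/-- The truth value of a formula of modal logic is computed by a single neuron in all sufficiently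
deep layers: on `{0, 1}` the activation function is the identity, and `1 - x - y` is mapped to the
truth value of the negated disjunction. -/
theorem exists_predInd_mem_neurons_maxAgg {f : ℝ → ℝ} (h₀ : ∀ x ≤ 0, f x = 0) (h₁ : f 1 = 1)
    (φ : MLFormula k) :
    ∃ ℓ, ∀ m ≥ ℓ, predInd (fun p : PointedGraph.{u} k => φ.Sat p.graph p.vertex) ∈
      neurons maxAgg f k m := by
  have hf : ∀ (Q : PointedGraph.{u} k → Prop) p, f (predInd Q p) = predInd Q p := by
    intro Q p
    rcases predInd_eq_zero_or_one Q p with h | h <;> simp [h, h₀, h₁]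
  have hneg : ∀ (Q : PointedGraph.{u} k → Prop) m, predInd Q ∈ neurons maxAgg f k m →
      predInd (fun p => ¬ Q p) ∈ neurons maxAgg f k (m + 1) := by
    intro Q m hQ
    refine comp_mem_neurons
      (Submodule.sub_mem _ (one_mem_preActivations _ _) (mem_preActivations hQ)) fun p => ?_
    by_cases h : Q p <;> simp [predInd, h, h₀, h₁]
  have hmono : ∀ (Q : PointedGraph.{u} k → Prop) ℓ, predInd Q ∈ neurons maxAgg f k ℓ →
      ∀ m ≥ ℓ, predInd Q ∈ neurons maxAgg f k m := fun Q ℓ hQ m hm => by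
    induction m, hm using Nat.le_induction with
    | base => exact hQ
    | succ m _ ih => exact comp_mem_neurons (mem_preActivations ih) (hf Q)
  induction φ with
  | atom i =>
    refine ⟨0, hmono _ 0 ⟨i, ?_⟩⟩
    exact labelInd_eq_predInd i
  | neg φ ih =>
    obtain ⟨ℓ, h⟩ := ih
    exact ⟨ℓ + 1, hmono _ _ (hneg _ _ (h ℓ le_rfl))⟩
  | or φ ψ ihφ ihψ =>
    obtain ⟨ℓ, h⟩ := ihφ
    obtain ⟨ℓ', h'⟩ := ihψ
    have hnor : predInd (fun p : PointedGraph.{u} k =>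
        ¬ (φ.Sat p.graph p.vertex ∨ ψ.Sat p.graph p.vertex)) ∈
          neurons maxAgg f k (max ℓ ℓ' + 1) := by
      refine comp_mem_neurons (Submodule.sub_mem _ (Submodule.sub_mem _
        (one_mem_preActivations _ _) (mem_preActivations (h _ (le_max_left ℓ ℓ'))))
        (mem_preActivations (h' _ (le_max_right ℓ ℓ')))) fun p => ?_
      by_cases hφ : φ.Sat p.graph p.vertex <;> by_cases hψ : ψ.Sat p.graph p.vertex <;>
        simp [predInd, hφ, hψ, h₀, h₁]
    refine ⟨max ℓ ℓ' + 2, hmono _ _ ?_⟩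
    have := hneg _ _ hnor
    simp only [not_not] at this
    exact this
  | dia φ ih =>
    obtain ⟨ℓ, h⟩ := ih
    refine ⟨ℓ + 1, hmono _ _ (comp_mem_neurons (aggSucc_mem_preActivations (h ℓ le_rfl))
      fun p => ?_)⟩
    rw [aggSucc_maxAgg_predInd, hf]
    rfl

/-- Every formula of modal logic is equivalent to a simple network with maximum aggregation. -/
theorem mlClass_subset_simpleGNNClass {f : ℝ → ℝ} (h₀ : ∀ x ≤ 0, f x = 0) (h₁ : f 1 = 1) :
    mlClass.{u} k ⊆ simpleGNNClass.{u} maxAgg f k := by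
  rintro _ ⟨φ, rfl⟩
  obtain ⟨ℓ, h⟩ := exists_predInd_mem_neurons_maxAgg.{u} h₀ h₁ φ
  have := setOf_le_mem_simpleGNNClass isComponentwise_maxAgg (Nat.le_add_left 1 ℓ)
    (h (ℓ + 1) (Nat.le_succ ℓ)) 1
  convert this using 1
  ext p
  by_cases hp : φ.Sat p.graph p.vertex <;> simp [predInd, hp]

/-! ### From counting logics to simple networks with linear aggregation -/

/-- The aggregation over successors is a linear operator on functions on pointed graphs. -/
def IsLinearAgg (agg : Aggregation) (k : ℕ) : Prop :=
  ∃ Λ : Module.End ℝ (PointedGraph.{u} k → ℝ), ∀ g, Λ g = aggSucc agg g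

theorem isLinearAgg_sumAgg : IsLinearAgg.{u} sumAgg k := by
  refine ⟨⟨⟨aggSucc sumAgg, fun g h => ?_⟩, fun r g => ?_⟩, fun g => rfl⟩
  · funext p
    simp [aggSucc_sumAgg, Finset.sum_add_distrib]
  · funext p
    simp [aggSucc_sumAgg, Finset.mul_sum]

theorem isLinearAgg_meanAgg : IsLinearAgg.{u} meanAgg k := by
  refine ⟨⟨⟨aggSucc meanAgg, fun g h => ?_⟩, fun r g => ?_⟩, fun g => rfl⟩
  · funext p
    simp [aggSucc_meanAgg, Finset.sum_add_distrib, mul_add]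
  · funext p
    simp [aggSucc_meanAgg, ← Finset.mul_sum, mul_left_comm]

theorem aggSucc_mem_of_mem_span {agg : Aggregation} (hagg : IsLinearAgg.{u} agg k)
    {K : Set (PointedGraph.{u} k → ℝ)} {g : PointedGraph.{u} k → ℝ}
    (hg : g ∈ Submodule.span ℝ K) : aggSucc agg g ∈ preActivations agg K := by
  obtain ⟨Λ, hΛ⟩ := hagg
  rw [← hΛ]
  have : Submodule.map Λ (Submodule.span ℝ K) ≤ preActivations agg K := by
    rw [Submodule.map_span_le]
    intro h hh
    rw [hΛ]
    exact aggSucc_mem_preActivations hh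
  exact this (Submodule.mem_map_of_mem hg)

theorem span_le_preActivations {agg : Aggregation} (K : Set (PointedGraph.{u} k → ℝ)) :
    Submodule.span ℝ K ≤ preActivations agg K :=
  Submodule.span_mono fun _ h => Or.inl (Or.inl h)

/-- On graphs of bounded size, an affine combination of neurons and their aggregates that takes
finitely many values may be postcomposed with any function: on these values the function is a
linear combination of translates and dilates of the activation function. -/
theorem exists_comp_mem_span_neurons {agg : Aggregation} {f : ℝ → ℝ} (hf : Continuous f)
    (hp : ¬ IsPolynomialFun f) {n ℓ : ℕ} {v : PointedGraph.{u} k → ℝ}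
    (hv : v ∈ preActivations agg (neurons agg f k ℓ)) (S : Finset ℝ)
    (hS : ∀ p : PointedGraph.{u} k, p.graph.size ≤ n → v p ∈ S) (g : ℝ → ℝ) :
    ∃ v' ∈ Submodule.span ℝ (neurons agg f k (ℓ + 1)),
      ∀ p : PointedGraph.{u} k, p.graph.size ≤ n → v' p = g (v p) := by
  obtain ⟨c, hc⟩ := exists_interpolation hf hp S g
  refine ⟨∑ z ∈ c.support, c z • (f ∘ (z.1 • 1 + z.2 • v)), ?_, fun p hsize => ?_⟩
  · refine Submodule.sum_mem _ fun z _ => Submodule.smul_mem _ _ (Submodule.subset_span ?_)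
    exact ⟨_, Submodule.add_mem _ (Submodule.smul_mem _ _ (one_mem_preActivations _ _))
      (Submodule.smul_mem _ _ hv), rfl⟩
  · rw [hc _ (hS p hsize), Finsupp.sum]
    simp [mul_comm]

/-- On graphs of size at most `n`, the truth value of `Q` is a linear combination of neurons of
every sufficiently deep layer. -/
def SpanComputable (agg : Aggregation) (f : ℝ → ℝ) (n : ℕ) (Q : PointedGraph.{u} k → Prop) :
    Prop :=
  ∃ ℓ, ∀ m ≥ ℓ, ∃ v ∈ Submodule.span ℝ (neurons agg f k m),
    ∀ p : PointedGraph.{u} k, p.graph.size ≤ n → v p = predInd Q p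

section SpanComputable

variable {agg : Aggregation} {f : ℝ → ℝ} {n : ℕ} {Q Q' : PointedGraph.{u} k → Prop}

theorem spanComputable_of_eq (hf : Continuous f) (hp : ¬ IsPolynomialFun f) {ℓ : ℕ}
    {v : PointedGraph.{u} k → ℝ} (hv : v ∈ Submodule.span ℝ (neurons agg f k ℓ))
    (h : ∀ p : PointedGraph.{u} k, p.graph.size ≤ n → v p = predInd Q p) :
    SpanComputable agg f n Q := by
  classical
  refine ⟨ℓ, fun m hm => ?_⟩
  induction m, hm using Nat.le_induction with
  | base => exact ⟨v, hv, h⟩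
  | succ m _ ih =>
    obtain ⟨v, hv, h⟩ := ih
    obtain ⟨v', hv', h'⟩ := exists_comp_mem_span_neurons (n := n) hf hp
      (span_le_preActivations _ hv) {0, 1} (fun p hsize => by
        simpa [h p hsize] using predInd_eq_zero_or_one Q p) id
    exact ⟨v', hv', fun p hsize => (h' p hsize).trans (h p hsize)⟩

theorem spanComputable_label (hf : Continuous f) (hp : ¬ IsPolynomialFun f) (i : Fin k) :
    SpanComputable agg f n fun p : PointedGraph.{u} k => i ∈ p.graph.label p.vertex := by
  refine spanComputable_of_eq hf hp (ℓ := 0) (Submodule.subset_span ⟨i, rfl⟩) fun p _ => ?_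
  exact congrFun (labelInd_eq_predInd i) p

theorem SpanComputable.not (hf : Continuous f) (hp : ¬ IsPolynomialFun f)
    (hQ : SpanComputable agg f n Q) : SpanComputable agg f n fun p => ¬ Q p := by
  classical
  obtain ⟨ℓ, h⟩ := hQ
  obtain ⟨v, hv, h⟩ := h ℓ le_rfl
  obtain ⟨v', hv', h'⟩ := exists_comp_mem_span_neurons (n := n) hf hp
    (span_le_preActivations _ hv) {0, 1} (fun p hsize => by
      simpa [h p hsize] using predInd_eq_zero_or_one Q p) (fun x => 1 - x)
  refine spanComputable_of_eq hf hp hv' fun p hsize => ?_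
  rw [h' p hsize, h p hsize]
  by_cases hq : Q p <;> simp [predInd, hq]

theorem SpanComputable.or (hf : Continuous f) (hp : ¬ IsPolynomialFun f)
    (hQ : SpanComputable agg f n Q) (hQ' : SpanComputable agg f n Q') :
    SpanComputable agg f n fun p => Q p ∨ Q' p := by
  classical
  obtain ⟨ℓ, h⟩ := hQ
  obtain ⟨ℓ', h'⟩ := hQ'
  obtain ⟨v, hv, h⟩ := h _ (le_max_left ℓ ℓ')
  obtain ⟨v', hv', h'⟩ := h' _ (le_max_right ℓ ℓ')
  obtain ⟨y, hy, hy'⟩ := exists_comp_mem_span_neurons (n := n) hf hp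
    (span_le_preActivations _ (Submodule.add_mem _ hv hv')) {0, 1, 2} (fun p hsize => by
      rw [Pi.add_apply, h p hsize, h' p hsize]
      rcases predInd_eq_zero_or_one Q p with e | e <;>
        rcases predInd_eq_zero_or_one Q' p with e' | e' <;> norm_num [e, e']) (fun x => min x 1)
  refine spanComputable_of_eq hf hp hy fun p hsize => ?_
  rw [hy' p hsize, Pi.add_apply, h p hsize, h' p hsize]
  by_cases hq : Q p <;> by_cases hq' : Q' p <;> norm_num [predInd, hq, hq']

/-- Conditions on the aggregated truth value of a computable predicate are computable. -/
theorem SpanComputable.aggSucc (hf : Continuous f) (hp : ¬ IsPolynomialFun f)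
    (hagg : IsLinearAgg.{u} agg k) (hQ : SpanComputable agg f n Q) (S : Finset ℝ)
    (hS : ∀ p : PointedGraph.{u} k, p.graph.size ≤ n → aggSucc agg (predInd Q) p ∈ S)
    (R : ℝ → Prop) : SpanComputable agg f n fun p => R (aggSucc agg (predInd Q) p) := by
  classical
  obtain ⟨ℓ, h⟩ := hQ
  obtain ⟨v, hv, h⟩ := h ℓ le_rfl
  have he : ∀ p : PointedGraph.{u} k, p.graph.size ≤ n →
      NonUniformGNN.aggSucc agg v p = NonUniformGNN.aggSucc agg (predInd Q) p := by
    intro p hsize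
    unfold NonUniformGNN.aggSucc
    congr 1
    exact Multiset.map_congr rfl fun w _ => h ⟨p.graph, w⟩ hsize
  obtain ⟨v', hv', h'⟩ := exists_comp_mem_span_neurons (n := n) hf hp
    (aggSucc_mem_of_mem_span hagg hv) S (fun p hsize => he p hsize ▸ hS p hsize)
    (fun x => if R x then 1 else 0)
  refine spanComputable_of_eq hf hp hv' fun p hsize => ?_
  rw [h' p hsize, he p hsize]
  rfl

/-- A computable predicate is accepted by a simple network: a final neuron sends the truth values
`0` and `1` to two arguments at which the activation function differs. -/
theorem SpanComputable.exists_mem_simpleGNNClass (hp : ¬ IsPolynomialFun f)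
    (hagg : IsComponentwise agg) (hQ : SpanComputable agg f n Q) :
    ∃ S ∈ simpleGNNClass.{u} agg f k, ∀ p : PointedGraph.{u} k, p.graph.size ≤ n →
      (p ∈ S ↔ Q p) := by
  obtain ⟨s, t, hst⟩ : ∃ s t, f s < f t := by
    by_contra! hcon
    exact hp ⟨Polynomial.C (f 0), fun x => by simpa using le_antisymm (hcon 0 x) (hcon x 0)⟩
  obtain ⟨ℓ, h⟩ := hQ
  obtain ⟨v, hv, h⟩ := h ℓ le_rfl
  have hmem : f ∘ (s • 1 + (t - s) • v) ∈ neurons agg f k (ℓ + 1) :=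
    ⟨_, Submodule.add_mem _ (Submodule.smul_mem _ _ (one_mem_preActivations _ _))
      (Submodule.smul_mem _ _ (span_le_preActivations _ hv)), rfl⟩
  refine ⟨_, setOf_le_mem_simpleGNNClass hagg (Nat.le_add_left 1 ℓ) hmem (f t),
    fun p hsize => ?_⟩
  by_cases hq : Q p <;> simp [h p hsize, predInd, hq, hst]

end SpanComputable

theorem card_succs_le_size (G : LabeledGraph.{u} k) (v : G.V) : (G.succs v).card ≤ G.size :=
  Finset.card_le_univ _

open Classical in
theorem sum_predInd (Q : PointedGraph.{u} k → Prop) (p : PointedGraph.{u} k) :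
    ∑ w ∈ p.graph.succs p.vertex, predInd Q ⟨p.graph, w⟩ =
      ((p.graph.succs p.vertex).filter fun w => Q ⟨p.graph, w⟩).card := by
  simp [predInd]

theorem spanComputable_gml {f : ℝ → ℝ} (hf : Continuous f) (hp : ¬ IsPolynomialFun f) (n : ℕ)
    (φ : GMLFormula k) :
    SpanComputable sumAgg f n fun p : PointedGraph.{u} k => φ.Sat p.graph p.vertex := by
  classical
  induction φ with
  | atom i => exact spanComputable_label hf hp i
  | neg φ ih => exact ih.not hf hp
  | or φ ψ ihφ ihψ => exact ihφ.or hf hp ihψ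
  | dia m φ ih =>
    have := ih.aggSucc hf hp isLinearAgg_sumAgg ((Finset.range (n + 1)).image (Nat.cast : ℕ → ℝ))
      (fun p hsize => by
        rw [aggSucc_sumAgg, sum_predInd]
        refine Finset.mem_image_of_mem _ (Finset.mem_range_succ_iff.2 ?_)
        exact (Finset.card_filter_le _ _).trans ((card_succs_le_size _ _).trans hsize))
      (fun x => (m : ℝ) ≤ x)
    simp only [aggSucc_sumAgg, sum_predInd, Nat.cast_le] at this
    convert this using 2
    simp only [GMLFormula.Sat]

theorem spanComputable_rml {f : ℝ → ℝ} (hf : Continuous f) (hp : ¬ IsPolynomialFun f) (n : ℕ)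
    (φ : RMLFormula k) :
    SpanComputable meanAgg f n fun p : PointedGraph.{u} k => φ.Sat p.graph p.vertex := by
  classical
  have key : ∀ Q : PointedGraph.{u} k → Prop, SpanComputable meanAgg f n Q → ∀ R : ℝ → Prop,
      SpanComputable meanAgg f n fun p => R (((p.graph.succs p.vertex).card : ℝ)⁻¹ *
        ((p.graph.succs p.vertex).filter fun w => Q ⟨p.graph, w⟩).card) := by
    intro Q hQ R
    have := hQ.aggSucc hf hp isLinearAgg_meanAgg
      ((Finset.range (n + 1) ×ˢ Finset.range (n + 1)).image fun z : ℕ × ℕ => (z.1 : ℝ)⁻¹ * z.2)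
      (fun p hsize => by
        rw [aggSucc_meanAgg, sum_predInd]
        refine Finset.mem_image.2 ⟨(_, _), Finset.mem_product.2 ⟨Finset.mem_range_succ_iff.2 ?_,
          Finset.mem_range_succ_iff.2 ?_⟩, rfl⟩
        · exact (card_succs_le_size _ _).trans hsize
        · exact (Finset.card_filter_le _ _).trans ((card_succs_le_size _ _).trans hsize)) R
    simp only [aggSucc_meanAgg, sum_predInd] at this
    exact this
  induction φ with
  | atom i => exact spanComputable_label hf hp i
  | neg φ ih => exact ih.not hf hp
  | or φ ψ ihφ ihψ => exact ihφ.or hf hp ihψ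
  | diaGE r φ ih =>
    -- The fraction of successors satisfying `φ` is at least `r` if and only if that of successors
    -- violating `φ` is at most `1 - r`. In the latter form the value `0` of the mean over an empty
    -- set gives the right answer.
    have := key _ (ih.not hf hp) (fun x => x ≤ 1 - r)
    convert this using 2 with p
    rcases (p.graph.succs p.vertex).eq_empty_or_nonempty with h | h
    · simp [RMLFormula.Sat, h, r.2.2]
    · have hc : (0 : ℝ) < (p.graph.succs p.vertex).card := by exact_mod_cast h.card_pos
      have hadd := Finset.card_filter_add_card_filter_not (s := p.graph.succs p.vertex)
        (fun w => φ.Sat p.graph w)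
      have hadd' : (((p.graph.succs p.vertex).filter fun w => φ.Sat p.graph w).card : ℝ) +
        ((p.graph.succs p.vertex).filter fun w => ¬ φ.Sat p.graph w).card =
          (p.graph.succs p.vertex).card := by exact_mod_cast hadd
      simp only [RMLFormula.Sat, h.ne_empty, false_or]
      rw [inv_mul_eq_div, div_le_iff₀ hc, le_div_iff₀ hc]
      constructor <;> intro h' <;> linarith
  | diaGT r φ ih =>
    have := key _ ih (fun x => (r : ℝ) < x)
    convert this using 2 with p
    rcases (p.graph.succs p.vertex).eq_empty_or_nonempty with h | h
    · simp [RMLFormula.Sat, h, r.2.1]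
    · simp only [RMLFormula.Sat, h.ne_empty, ne_eq, not_false_eq_true, true_and, inv_mul_eq_div]

/-! ### Functions with finitely many values and definable fibers -/

section FinDefinable

variable {X α β ι : Type*} (B : BooleanSubalgebra (Set X))

/-- A function with finitely many values all of whose fibers belong to the Boolean algebra `B`. -/
def FinDefinable (g : X → α) : Prop :=
  (Set.range g).Finite ∧ ∀ a, {x | g x = a} ∈ B

variable {B}

theorem biUnion_mem_booleanSubalgebra (F : Finset ι) (s : ι → Set X) (hs : ∀ i ∈ F, s i ∈ B) :
    {x | ∃ i ∈ F, x ∈ s i} ∈ B := by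
  classical
  induction F using Finset.induction_on with
  | empty => simpa using B.bot_mem
  | insert a F _ ih =>
    have := B.sup_mem (hs a (Finset.mem_insert_self _ _))
      (ih fun i hi => hs i (Finset.mem_insert_of_mem hi))
    convert this using 1
    ext x
    simp

theorem biInter_mem_booleanSubalgebra (F : Finset ι) (s : ι → Set X) (hs : ∀ i ∈ F, s i ∈ B) :
    {x | ∀ i ∈ F, x ∈ s i} ∈ B := by
  have := B.compl_mem (biUnion_mem_booleanSubalgebra F (fun i => (s i)ᶜ)
    fun i hi => B.compl_mem (hs i hi))
  convert this using 1
  ext x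
  simp

theorem FinDefinable.comp {g : X → α} (hg : FinDefinable B g) (h : α → β) :
    FinDefinable B fun x => h (g x) := by
  classical
  refine ⟨(hg.1.image h).subset (by rintro _ ⟨x, rfl⟩; exact ⟨g x, ⟨x, rfl⟩, rfl⟩), fun b => ?_⟩
  have := biUnion_mem_booleanSubalgebra (B := B) (hg.1.toFinset.filter fun a => h a = b)
    (fun a => {x | g x = a}) fun a _ => hg.2 a
  convert this using 1
  ext x
  simp

theorem FinDefinable.pi [Fintype ι] {α : ι → Type*} {g : ∀ i, X → α i}
    (hg : ∀ i, FinDefinable B (g i)) : FinDefinable B fun x i => g i x := by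
  refine ⟨(Set.Finite.pi' fun i => (hg i).1).subset (by rintro _ ⟨x, rfl⟩ i; exact ⟨x, rfl⟩),
    fun a => ?_⟩
  have := biInter_mem_booleanSubalgebra (B := B) Finset.univ (fun i => {x | g i x = a i})
    fun i _ => (hg i).2 (a i)
  convert this using 1
  ext x
  simp [funext_iff]

theorem FinDefinable.prodMk {g : X → α} {h : X → β} (hg : FinDefinable B g)
    (hh : FinDefinable B h) : FinDefinable B fun x => (g x, h x) := by
  refine ⟨(hg.1.prod hh.1).subset (by rintro _ ⟨x, rfl⟩; exact ⟨⟨x, rfl⟩, ⟨x, rfl⟩⟩),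
    fun a => ?_⟩
  convert B.inf_mem (hg.2 a.1) (hh.2 a.2) using 1
  ext x
  simp [Prod.ext_iff]

theorem finDefinable_prop {Q : X → Prop} : FinDefinable B Q ↔ {x | Q x} ∈ B := by
  refine ⟨fun h => by simpa using h.2 True, fun h => ⟨Set.toFinite _, fun a => ?_⟩⟩
  by_cases ha : a
  · simpa [ha] using h
  · convert B.compl_mem h using 1
    ext x
    simp [ha]

end FinDefinable

/-! ### From networks to logics -/

/-- The pointed graphs of size at most `n`. -/
abbrev BoundedPointedGraph (k n : ℕ) : Type (u + 1) :=
  {p : PointedGraph.{u} k // p.graph.size ≤ n}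

variable {n : ℕ}

/-- The same graph with another distinguished vertex. -/
def BoundedPointedGraph.repoint (p : BoundedPointedGraph.{u} k n) (w : p.1.graph.V) :
    BoundedPointedGraph.{u} k n :=
  ⟨⟨p.1.graph, w⟩, p.2⟩

/-- The successors of the distinguished vertex. -/
def BoundedPointedGraph.succs (p : BoundedPointedGraph.{u} k n) : Finset p.1.graph.V :=
  p.1.graph.succs p.1.vertex

/-- The multiset of values of a function at the successors of the distinguished vertex. -/
def BoundedPointedGraph.succValues {α : Type*} (p : BoundedPointedGraph.{u} k n)
    (g : BoundedPointedGraph.{u} k n → α) : Multiset α :=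
  p.succs.val.map fun w => g (p.repoint w)

theorem BoundedPointedGraph.card_succs_le (p : BoundedPointedGraph.{u} k n) : p.succs.card ≤ n :=
  (card_succs_le_size _ _).trans p.2

/-- A Boolean algebra of definable sets can handle an aggregation function if the aggregates of
definable functions over successors are again definable. -/
def HandlesAgg (B : BooleanSubalgebra (Set (BoundedPointedGraph.{u} k n))) (agg : Aggregation) :
    Prop :=
  ∀ (d : ℕ) (g : BoundedPointedGraph.{u} k n → Fin d → ℝ), FinDefinable B g →
    FinDefinable B fun p => agg d (p.succValues g)

theorem finDefinable_feature {B : BooleanSubalgebra (Set (BoundedPointedGraph.{u} k n))}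
    {agg : Aggregation} (hlabel : ∀ i : Fin k, {p | i ∈ p.1.graph.label p.1.vertex} ∈ B)
    (hagg : HandlesAgg B agg) (N : GNN agg k) (ℓ : ℕ) :
    FinDefinable B fun p => N.feature p.1.graph ℓ p.1.vertex := by
  induction ℓ with
  | zero =>
    refine FinDefinable.pi fun i => ?_
    suffices h : FinDefinable B fun p : BoundedPointedGraph.{u} k n =>
        ∃ h : (i : ℕ) < k, (⟨i, h⟩ : Fin k) ∈ p.1.graph.label p.1.vertex by
      classical
      convert h.comp fun q => if q then (1 : ℝ) else 0 using 2 with p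
      unfold GNN.feature
      congr!
    rw [finDefinable_prop]
    by_cases hi : (i : ℕ) < k
    · simpa [hi] using hlabel ⟨i, hi⟩
    · simpa [hi] using B.bot_mem
  | succ ℓ ih =>
    exact (ih.prodMk (hagg _ _ ih)).comp fun z => N.com ℓ z.1 z.2

theorem accepted_mem {B : BooleanSubalgebra (Set (BoundedPointedGraph.{u} k n))}
    {agg : Aggregation} (hlabel : ∀ i : Fin k, {p | i ∈ p.1.graph.label p.1.vertex} ∈ B)
    (hagg : HandlesAgg B agg) (N : GNN agg k) : {p | p.1 ∈ N.accepted} ∈ B :=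
  finDefinable_prop.1 ((finDefinable_feature hlabel hagg N N.L).comp N.Cls)

/-- The sets of pointed graphs of size at most `n` that are defined by formulas of a logic with
negation and disjunction. At least one formula is needed to define the empty set. -/
def definableSets {Φ : Type} (n : ℕ) (sat : Φ → PointedGraph.{u} k → Prop) (φ₀ : Φ)
    (neg : Φ → Φ) (or : Φ → Φ → Φ) (hneg : ∀ φ p, sat (neg φ) p ↔ ¬ sat φ p)
    (hor : ∀ φ ψ p, sat (or φ ψ) p ↔ sat φ p ∨ sat ψ p) :
    BooleanSubalgebra (Set (BoundedPointedGraph.{u} k n)) where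
  carrier := Set.range fun φ => {p | sat φ p.1}
  supClosed' := by
    rintro _ ⟨φ, rfl⟩ _ ⟨ψ, rfl⟩
    exact ⟨or φ ψ, by ext p; simp [hor]⟩
  infClosed' := by
    rintro _ ⟨φ, rfl⟩ _ ⟨ψ, rfl⟩
    exact ⟨neg (or (neg φ) (neg ψ)), by ext p; simp [hor, hneg]⟩
  compl_mem' := by
    rintro _ ⟨φ, rfl⟩
    exact ⟨neg φ, by ext p; simp [hneg]⟩
  bot_mem' := ⟨neg (or φ₀ (neg φ₀)), by ext p; simp [hor, hneg, em]⟩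

/-- The sets of pointed graphs of size at most `n` that are definable in modal logic. -/
def mlSets (hk : 1 ≤ k) (n : ℕ) : BooleanSubalgebra (Set (BoundedPointedGraph.{u} k n)) :=
  definableSets n (fun φ p => φ.Sat p.graph p.vertex) (MLFormula.atom ⟨0, hk⟩) .neg .or
    (fun _ _ => Iff.rfl) (fun _ _ _ => Iff.rfl)

/-- The sets of pointed graphs of size at most `n` that are definable in graded modal logic. -/
def gmlSets (hk : 1 ≤ k) (n : ℕ) : BooleanSubalgebra (Set (BoundedPointedGraph.{u} k n)) :=
  definableSets n (fun φ p => φ.Sat p.graph p.vertex) (GMLFormula.atom ⟨0, hk⟩) .neg .or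
    (fun _ _ => Iff.rfl) (fun _ _ _ => Iff.rfl)

/-- The sets of pointed graphs of size at most `n` that are definable in ratio modal logic. -/
def rmlSets (hk : 1 ≤ k) (n : ℕ) : BooleanSubalgebra (Set (BoundedPointedGraph.{u} k n)) :=
  definableSets n (fun φ p => φ.Sat p.graph p.vertex) (RMLFormula.atom ⟨0, hk⟩) .neg .or
    (fun _ _ => Iff.rfl) (fun _ _ _ => Iff.rfl)

/-- The maximum is determined by the set of values that occur at successors, and diamonds define
which values these are. -/
theorem handlesAgg_maxAgg (hk : 1 ≤ k) (n : ℕ) : HandlesAgg (mlSets.{u} hk n) maxAgg := by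
  classical
  intro d g hg
  have hocc : ∀ a : hg.1.toFinset, FinDefinable (mlSets.{u} hk n)
      fun p : BoundedPointedGraph.{u} k n => ∃ w ∈ p.succs, g (p.repoint w) = a := by
    intro a
    obtain ⟨φ, hφ⟩ := hg.2 a
    rw [finDefinable_prop]
    refine ⟨.dia φ, ?_⟩
    ext p
    have h : ∀ w, φ.Sat p.1.graph w ↔ g (p.repoint w) = a := fun w => Set.ext_iff.1 hφ (p.repoint w)
    simp only [Set.mem_ofPred_eq, MLFormula.Sat, h]
    rfl
  convert (FinDefinable.pi hocc).comp fun t =>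
    maxAgg d ((Finset.univ.filter fun a => t a).val.map Subtype.val) using 2 with p
  refine maxAgg_congr fun x => ?_
  simp only [BoundedPointedGraph.succValues, Multiset.mem_map, Finset.mem_val, Finset.mem_filter,
    Finset.mem_univ, true_and, Subtype.exists]
  constructor
  · rintro ⟨w, hw, rfl⟩
    exact ⟨_, by simp, ⟨w, hw, rfl⟩, rfl⟩
  · rintro ⟨a, _, ⟨w, hw, rfl⟩, rfl⟩
    exact ⟨w, hw, rfl⟩

open Classical in
/-- A sum over successors grouped by the finitely many values of the summand. -/
theorem sum_succValues_eq {d : ℕ} {g : BoundedPointedGraph.{u} k n → Fin d → ℝ}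
    (hg : (Set.range g).Finite) (p : BoundedPointedGraph.{u} k n) :
    (p.succValues g).sum =
      ∑ a : hg.toFinset, ((p.succs.filter fun w => g (p.repoint w) = a).card : ℝ) •
        (a : Fin d → ℝ) := by
  have h := Finset.sum_fiberwise_of_maps_to (s := p.succs) (t := hg.toFinset)
    (g := fun w => g (p.repoint w)) (fun w _ => by simp) (fun w => g (p.repoint w))
  rw [Finset.sum_coe_sort hg.toFinset
    (fun a => ((p.succs.filter fun w => g (p.repoint w) = a).card : ℝ) • a)]
  refine Eq.trans h.symm (Finset.sum_congr rfl fun a _ => ?_)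
  rw [Finset.sum_congr rfl fun w hw => (Finset.mem_filter.1 hw).2, Finset.sum_const,
    Nat.cast_smul_eq_nsmul]

theorem handlesAgg_sumAgg (hk : 1 ≤ k) (n : ℕ) : HandlesAgg (gmlSets.{u} hk n) sumAgg := by
  classical
  intro d g hg
  have hcount : ∀ a : hg.1.toFinset, FinDefinable (gmlSets.{u} hk n)
      fun p : BoundedPointedGraph.{u} k n =>
        (p.succs.filter fun w => g (p.repoint w) = a).card := by
    intro a
    obtain ⟨φ, hφ⟩ := hg.2 a
    refine ⟨(Set.finite_Iic n).subset ?_, fun m => ?_⟩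
    · rintro _ ⟨p, rfl⟩
      exact (Finset.card_filter_le _ _).trans p.card_succs_le
    · have hdia : ∀ m : ℕ, {p : BoundedPointedGraph.{u} k n |
          m ≤ (p.succs.filter fun w => g (p.repoint w) = a).card} ∈ gmlSets.{u} hk n := by
        intro m
        refine ⟨.dia m φ, ?_⟩
        ext p
        have h : ∀ w, φ.Sat p.1.graph w ↔ g (p.repoint w) = a :=
          fun w => Set.ext_iff.1 hφ (p.repoint w)
        simp only [Set.mem_ofPred_eq, GMLFormula.Sat, h]
        exact Eq.to_iff (by congr!)
      convert BooleanSubalgebra.inf_mem (hdia m) (BooleanSubalgebra.compl_mem (hdia (m + 1)))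
        using 1
      ext p
      simp only [Set.inf_eq_inter, Set.mem_inter_iff, Set.mem_compl_iff, Set.mem_ofPred_eq]
      omega
  convert (FinDefinable.pi hcount).comp fun t =>
    ∑ a : hg.1.toFinset, (t a : ℝ) • (a : Fin d → ℝ) using 2 with p
  exact sum_succValues_eq hg.1 p

theorem handlesAgg_meanAgg (hk : 1 ≤ k) (n : ℕ) : HandlesAgg (rmlSets.{u} hk n) meanAgg := by
  classical
  intro d g hg
  -- At vertices without successors the fraction is `0 / 0 = 0`, as required for the empty mean.
  have hfrac : ∀ a : hg.1.toFinset, FinDefinable (rmlSets.{u} hk n)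
      fun p : BoundedPointedGraph.{u} k n =>
        ((p.succs.filter fun w => g (p.repoint w) = a).card : ℝ) / (p.succs.card : ℝ) := by
    intro a
    obtain ⟨φ, hφ⟩ := hg.2 a
    refine ⟨(((Set.finite_Iic n).prod (Set.finite_Iic n)).image
      fun z : ℕ × ℕ => (z.1 : ℝ) / z.2).subset ?_, fun r => ?_⟩
    · rintro _ ⟨p, rfl⟩
      exact ⟨(_, _), ⟨(Finset.card_filter_le _ _).trans p.card_succs_le, p.card_succs_le⟩, rfl⟩
    · set q : BoundedPointedGraph.{u} k n → ℝ := fun p =>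
        ((p.succs.filter fun w => g (p.repoint w) = a).card : ℝ) / (p.succs.card : ℝ) with hq
      have hq0 : ∀ p, 0 ≤ q p := fun p => by positivity
      have hq1 : ∀ p, q p ≤ 1 := fun p =>
        div_le_one_of_le₀ (by exact_mod_cast Finset.card_filter_le _ _) (by positivity)
      have hqe : ∀ p : BoundedPointedGraph.{u} k n, p.succs = ∅ → q p = 0 := by
        intro p hp
        simp [hq, hp]
      have hfilter : ∀ p : BoundedPointedGraph.{u} k n,
          (((p.1.graph.succs p.1.vertex).filter fun w => φ.Sat p.1.graph w).card : ℝ) /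
            ((p.1.graph.succs p.1.vertex).card : ℝ) = q p := by
        intro p
        have h : ∀ w, φ.Sat p.1.graph w ↔ g (p.repoint w) = a :=
          fun w => Set.ext_iff.1 hφ (p.repoint w)
        simp only [h]
        rfl
      have hGT : ∀ r : Set.Icc (0 : ℝ) 1, {p | (r : ℝ) < q p} ∈ rmlSets.{u} hk n := by
        intro r
        refine ⟨.diaGT r φ, ?_⟩
        ext p
        simp only [Set.mem_ofPred_eq, RMLFormula.Sat]
        rw [← hfilter]
        refine and_iff_right_of_imp fun h he => ?_
        rw [he] at h
        simp only [Finset.filter_empty, Finset.card_empty, Nat.cast_zero, div_zero] at h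
        exact absurd r.2.1 h.not_ge
      have hGE : ∀ r : Set.Icc (0 : ℝ) 1, {p | p.succs = ∅ ∨ (r : ℝ) ≤ q p} ∈
          rmlSets.{u} hk n := by
        intro r
        refine ⟨.diaGE r φ, ?_⟩
        ext p
        simp only [Set.mem_ofPred_eq, RMLFormula.Sat]
        rw [← hfilter]
        rfl
      by_cases hr : r ∈ Set.Icc (0 : ℝ) 1
      · have hle := BooleanSubalgebra.compl_mem (hGT ⟨r, hr⟩)
        rcases hr.1.eq_or_lt with h0 | h0
        · convert hle using 1
          ext p
          simp only [Set.mem_compl_iff, Set.mem_ofPred_eq, not_lt]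
          exact ⟨fun h => h.le, fun h => le_antisymm h (h0 ▸ hq0 p)⟩
        · -- For `r > 0`, vertices without successors are excluded by the fraction being positive.
          convert BooleanSubalgebra.inf_mem hle (BooleanSubalgebra.inf_mem (hGE ⟨r, hr⟩)
            (hGT ⟨0, by simp⟩)) using 1
          ext p
          simp only [Set.inf_eq_inter, Set.mem_inter_iff, Set.mem_compl_iff, Set.mem_ofPred_eq,
            not_lt]
          constructor
          · intro h
            exact ⟨h.le, Or.inr h.ge, h.symm ▸ h0⟩
          · rintro ⟨h1, h2 | h2, h3⟩
            · exact absurd (hqe p h2) h3.ne'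
            · exact le_antisymm h1 h2
      · convert BooleanSubalgebra.bot_mem (L := rmlSets.{u} hk n) using 1
        ext p
        simp only [Set.mem_ofPred_eq, Set.bot_eq_empty, Set.mem_empty_iff_false, iff_false]
        rintro rfl
        exact hr ⟨hq0 p, hq1 p⟩
  convert (FinDefinable.pi hfrac).comp fun t =>
    ∑ a : hg.1.toFinset, (t a : ℝ) • (a : Fin d → ℝ) using 2 with p
  rw [meanAgg_eq, sum_succValues_eq hg.1 p, Finset.smul_sum]
  refine Finset.sum_congr rfl fun a _ => ?_
  rw [smul_smul, BoundedPointedGraph.succValues, Multiset.card_map, Finset.card_val,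
    inv_mul_eq_div]

/-! ### The equivalences in the non-uniform setting -/

theorem SizeMode.Admits.le {s : SizeMode} {n m : ℕ} (h : s.Admits n m) : m ≤ n := by
  cases s
  · exact Nat.le_of_eq h
  · exact h

/-- Inclusion in the non-uniform setting only needs simulation on graphs of bounded size. -/
theorem nonUniformSubset_of_simulation (s : SizeMode) {𝒞₁ 𝒞₂ : Set (Set (PointedGraph.{u} k))}
    (h : ∀ S ∈ 𝒞₁, ∀ n : ℕ, ∃ S' ∈ 𝒞₂, ∀ p : PointedGraph.{u} k, p.graph.size ≤ n →
      (p ∈ S' ↔ p ∈ S)) : NonUniformSubset s 𝒞₁ 𝒞₂ := by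
  intro P _ hP n
  obtain ⟨S, hS, hSP⟩ := hP n
  obtain ⟨S', hS', hSS'⟩ := h S hS n
  exact ⟨S', hS', fun G hG => (hSS' G hG.le).trans (hSP G hG)⟩

theorem NonUniformSubset.trans {s : SizeMode} {𝒞₁ 𝒞₂ 𝒞₃ : Set (Set (PointedGraph.{u} k))}
    (h : NonUniformSubset s 𝒞₁ 𝒞₂) (h' : NonUniformSubset s 𝒞₂ 𝒞₃) : NonUniformSubset s 𝒞₁ 𝒞₃ :=
  fun P hP hP₁ => h' P hP (h P hP hP₁)

theorem nonUniformSubset_of_subset (s : SizeMode) {𝒞₁ 𝒞₂ : Set (Set (PointedGraph.{u} k))}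
    (h : 𝒞₁ ⊆ 𝒞₂) : NonUniformSubset s 𝒞₁ 𝒞₂ :=
  nonUniformSubset_of_simulation s fun S hS _ => ⟨S, h hS, fun _ _ => Iff.rfl⟩

theorem simpleGNNClass_subset_gnnClass (agg : Aggregation) (f : ℝ → ℝ) :
    simpleGNNClass.{u} agg f k ⊆ gnnClass agg k :=
  fun _ ⟨N, _, hN⟩ => ⟨N, hN⟩

/-- Simple networks lie between the logic and all networks, so the circle closes once networks are
simulated by the logic. -/
theorem nonUniformEq_of_cycle {s : SizeMode} {agg : Aggregation} {f : ℝ → ℝ}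
    {𝓛 : Set (Set (PointedGraph.{u} k))}
    (h₁ : NonUniformSubset s (gnnClass agg k) 𝓛)
    (h₂ : NonUniformSubset s 𝓛 (simpleGNNClass agg f k)) :
    NonUniformEq s (gnnClass.{u} agg k) (simpleGNNClass agg f k) ∧
      NonUniformEq s (simpleGNNClass.{u} agg f k) 𝓛 :=
  have h₀ := nonUniformSubset_of_subset s (simpleGNNClass_subset_gnnClass.{u} (k := k) agg f)
  ⟨⟨h₁.trans h₂, h₀⟩, ⟨h₀.trans h₁, h₂⟩⟩

theorem gnnClass_maxAgg_subset (s : SizeMode) (hk : 1 ≤ k) :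
    NonUniformSubset.{u} s (gnnClass maxAgg k) (mlClass k) := by
  refine nonUniformSubset_of_simulation s ?_
  rintro _ ⟨N, rfl⟩ n
  obtain ⟨φ, hφ⟩ := accepted_mem (B := mlSets.{u} hk n) (fun i => ⟨.atom i, rfl⟩)
    (handlesAgg_maxAgg hk n) N
  exact ⟨_, ⟨φ, rfl⟩, fun p hp => Set.ext_iff.1 hφ ⟨p, hp⟩⟩

theorem gnnClass_sumAgg_subset (s : SizeMode) (hk : 1 ≤ k) :
    NonUniformSubset.{u} s (gnnClass sumAgg k) (gmlClass k) := by
  refine nonUniformSubset_of_simulation s ?_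
  rintro _ ⟨N, rfl⟩ n
  obtain ⟨φ, hφ⟩ := accepted_mem (B := gmlSets.{u} hk n) (fun i => ⟨.atom i, rfl⟩)
    (handlesAgg_sumAgg hk n) N
  exact ⟨_, ⟨φ, rfl⟩, fun p hp => Set.ext_iff.1 hφ ⟨p, hp⟩⟩

theorem gnnClass_meanAgg_subset (s : SizeMode) (hk : 1 ≤ k) :
    NonUniformSubset.{u} s (gnnClass meanAgg k) (rmlClass k) := by
  refine nonUniformSubset_of_simulation s ?_
  rintro _ ⟨N, rfl⟩ n
  obtain ⟨φ, hφ⟩ := accepted_mem (B := rmlSets.{u} hk n) (fun i => ⟨.atom i, rfl⟩)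
    (handlesAgg_meanAgg hk n) N
  exact ⟨_, ⟨φ, rfl⟩, fun p hp => Set.ext_iff.1 hφ ⟨p, hp⟩⟩

theorem gmlClass_subset (s : SizeMode) {f : ℝ → ℝ} (hf : Continuous f)
    (hp : ¬ IsPolynomialFun f) :
    NonUniformSubset.{u} s (gmlClass k) (simpleGNNClass sumAgg f k) := by
  refine nonUniformSubset_of_simulation s ?_
  rintro _ ⟨φ, rfl⟩ n
  exact (spanComputable_gml hf hp n φ).exists_mem_simpleGNNClass hp isComponentwise_sumAgg

theorem rmlClass_subset (s : SizeMode) {f : ℝ → ℝ} (hf : Continuous f)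
    (hp : ¬ IsPolynomialFun f) :
    NonUniformSubset.{u} s (rmlClass k) (simpleGNNClass meanAgg f k) := by
  refine nonUniformSubset_of_simulation s ?_
  rintro _ ⟨φ, rfl⟩ n
  exact (spanComputable_rml hf hp n φ).exists_mem_simpleGNNClass hp isComponentwise_meanAgg

end NonUniformGNN

end

theorem mainTheorem2 (s : NonUniformGNN.SizeMode) (k : ℕ) (hk : 1 ≤ k) :
    (∀ f : ℝ → ℝ, f = NonUniformGNN.truncRelu ∨ f = NonUniformGNN.relu →
      NonUniformGNN.NonUniformEq s
          (NonUniformGNN.gnnClass.{u} NonUniformGNN.maxAgg k)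
          (NonUniformGNN.simpleGNNClass.{u} NonUniformGNN.maxAgg f k) ∧
        NonUniformGNN.NonUniformEq s
          (NonUniformGNN.simpleGNNClass.{u} NonUniformGNN.maxAgg f k)
          (NonUniformGNN.mlClass.{u} k)) ∧
    (∀ f : ℝ → ℝ, f = NonUniformGNN.truncRelu ∨ f = NonUniformGNN.relu ∨
        (Continuous f ∧ ¬ NonUniformGNN.IsPolynomialFun f) →
      (NonUniformGNN.NonUniformEq s
          (NonUniformGNN.gnnClass.{u} NonUniformGNN.meanAgg k)
          (NonUniformGNN.simpleGNNClass.{u} NonUniformGNN.meanAgg f k) ∧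
        NonUniformGNN.NonUniformEq s
          (NonUniformGNN.simpleGNNClass.{u} NonUniformGNN.meanAgg f k)
          (NonUniformGNN.rmlClass.{u} k)) ∧
      (NonUniformGNN.NonUniformEq s
          (NonUniformGNN.gnnClass.{u} NonUniformGNN.sumAgg k)
          (NonUniformGNN.simpleGNNClass.{u} NonUniformGNN.sumAgg f k) ∧
        NonUniformGNN.NonUniformEq s
          (NonUniformGNN.simpleGNNClass.{u} NonUniformGNN.sumAgg f k)
          (NonUniformGNN.gmlClass.{u} k))) := by
  open NonUniformGNN in
  refine ⟨fun f hf => ?_, fun f hf => ?_⟩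
  · have h : (∀ x ≤ 0, f x = 0) ∧ f 1 = 1 := by
      rcases hf with rfl | rfl
      · exact ⟨fun x hx => by simp [truncRelu, hx], by norm_num [truncRelu]⟩
      · exact ⟨fun x hx => max_eq_left hx, by norm_num [relu]⟩
    exact nonUniformEq_of_cycle (gnnClass_maxAgg_subset s hk)
      (nonUniformSubset_of_subset s (mlClass_subset_simpleGNNClass h.1 h.2))
  · have h : Continuous f ∧ ¬ IsPolynomialFun f := by
      rcases hf with rfl | rfl | h
      · exact ⟨continuous_truncRelu, not_isPolynomialFun_truncRelu⟩
      · exact ⟨continuous_relu, not_isPolynomialFun_relu⟩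
      · exact h
    exact ⟨nonUniformEq_of_cycle (gnnClass_meanAgg_subset s hk) (rmlClass_subset s h.1 h.2),
      nonUniformEq_of_cycle (gnnClass_sumAgg_subset s hk) (gmlClass_subset s h.1 h.2)⟩
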